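/- Let $N\ge 1$ and $d$ be natural numbers and let $\Omega\subset\mathbb R^N$ be a bounded open set (for example a bounded Lipschitz domain; neither connectedness nor regularity of the boundary is needed). For $u\in SBV(\Omega;\mathbb R^d)$ write $Du=\nabla u\,\mathcal L^N+D^su$ for the Lebesgue decomposition of its distributional derivative, where $D^su=[u]\otimes\nu_u\,\mathcal H^{N-1}\lfloor S_u$, $S_u\subset\Omega$ is the jump set (the points with two distinct one-sided approximate limits $u^+,u^-$ with respect to a unit normal $\nu_u$) and $[u]=u^+-u^-$. Let $\alpha\in C_c^\infty(\mathbb R^N)$ have support in the open unit ball $B_1$ and satisfy $\int_{B_1}\alpha\,dx=1$, let $r>0$, and put $\alpha_r(x)=r^{-N}\alpha(x/r)$ and $\Omega_r=\{x\in\Omega:\operatorname{dist}(x,\partial\Omega)>r\}$. Let $\Psi:\Omega\times\mathbb R^{d\times N}\to[0,\infty)$ be continuous. Define, for $u\in SBV(\Omega;\mathbb R^d)$, $$E^{\alpha_r}(u)=\int_{\Omega_r}\Psi\big(x,(D^su*\alpha_r)(x)\big)\,dx,\qquad (\mu*\alpha_r)(x)=\int_\Omega\alpha_r(x-y)\,d\mu(y).$$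 Let $g\in SBV(\Omega;\mathbb R^d)$ and $G\in L^1(\Omega;\mathbb R^{d\times N})$, and let $(u_n)$ be any sequence in $\mathsf{Ad}(g,G)$, that is, $u_n\in SBV(\Omega;\mathbb R^d)$ for every $n$, $u_n\to g$ in $L^1(\Omega;\mathbb R^d)$, $\nabla u_n\,\mathcal L^N\rightharpoonup^* G\,\mathcal L^N$ and $D^su_n\rightharpoonup^*(\nabla g-G)\mathcal L^N+D^sg$, both weakly-* in the finite $\mathbb R^{d\times N}$-valued Radon measures on $\Omega$ (tested against $C_0(\Omega)$). Then all the integrals over $\Omega_r$ in this statement are finite, $$E^{\alpha_r}(u_n)=\int_{\Omega_r}\Psi\Big(x,\int_{B_r(x)\cap S_{u_n}}\alpha_r(x-y)\,[u_n](y)\otimes\nu_{u_n}(y)\,d\mathcal H^{N-1}(y)\Big)dx\quad\text{for every }n,$$ and $$\lim_{n\to\infty}E^{\alpha_r}(u_n)=I^{\alpha_r}(g,G;\Omega_r):=\int_{\Omega_r}\Psi\Big(x,\int_{B_r(x)}\alpha_r(x-y)(\nabla g-G)(y)\,dy+\int_{B_r(x)\cap S_g}\alpha_r(x-y)\,[g](y)\otimes\nu_g(y)\,d\mathcal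 H^{N-1}(y)\Big)dx.$$ -/

import Mathlib

open MeasureTheory Filter Topology Set
open scoped ContDiff ZeroAtInfty

noncomputable section

namespace SD

/-- The Euclidean space `ℝ^n`. -/
abbrev Sp (n : ℕ) : Type := EuclideanSpace ℝ (Fin n)

/-- Finite Radon measures with values in the `d × N` matrices, given by their entries. Such a measure
on an open set `Ω` is identified with the one on `ℝ^N` that is concentrated on `Ω`. -/
abbrev MatMeasure (d N : ℕ) : Type := Matrix (Fin d) (Fin N) (SignedMeasure (Sp N))

variable {d N : ℕ}

/-- The signed measure `μ` on `Ω` is the `j`-th distributional partial derivative of `f` in `Ω`. -/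
def IsDistPartial (Ω : Set (Sp N)) (f : Sp N → ℝ) (j : Fin N) (μ : SignedMeasure (Sp N)) : Prop :=
  μ.restrict Ω = μ ∧
  ∀ φ : Sp N → ℝ, ContDiff ℝ ∞ φ → HasCompactSupport φ → tsupport φ ⊆ Ω →
    ∫ x in Ω, f x * fderiv ℝ φ x (EuclideanSpace.single j 1) = - ∫ᵛ x, φ x ∂•μ

/-- `u ∈ BV(Ω; ℝ^d)`. -/
def IsBV (Ω : Set (Sp N)) (u : Sp N → Sp d) : Prop :=
  IntegrableOn u Ω ∧ ∀ (i : Fin d) (j : Fin N), ∃ μ, IsDistPartial Ω (fun x => u x i) j μ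

open Classical in
/-- The distributional derivative `Du` of a function of bounded variation. -/
def distDeriv (Ω : Set (Sp N)) (u : Sp N → Sp d) : MatMeasure d N :=
  Matrix.of fun i j =>
    if h : ∃ μ, IsDistPartial Ω (fun x => u x i) j μ then h.choose else 0

/-- `∇u`, the density of the absolutely continuous part of `Du` with respect to Lebesgue measure. -/
def grad (Ω : Set (Sp N)) (u : Sp N → Sp d) (x : Sp N) : Matrix (Fin d) (Fin N) ℝ :=
  Matrix.of fun i j => (distDeriv Ω u i j).rnDeriv volume x

/-- `D^s u`, the part of `Du` that is singular with respect to Lebesgue measure. -/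
def singDeriv (Ω : Set (Sp N)) (u : Sp N → Sp d) : MatMeasure d N :=
  Matrix.of fun i j => (distDeriv Ω u i j).singularPart volume

/-- `a` and `b` are distinct one-sided approximate limits of `u` at `x`, on the two sides of the
hyperplane through `x` with unit normal `ν`, i.e. `(a, b, ν) = (u⁺(x), u⁻(x), ν_u(x))`. -/
def IsJumpTriple (u : Sp N → Sp d) (x : Sp N) (a b : Sp d) (ν : Sp N) : Prop :=
  a ≠ b ∧ ‖ν‖ = 1 ∧
  Tendsto (fun ε : ℝ => (ε ^ N)⁻¹ *
      ∫ y in Metric.ball x ε ∩ {y | 0 < inner ℝ (y - x) ν}, ‖u y - a‖) (𝓝[>] 0) (𝓝 0) ∧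
  Tendsto (fun ε : ℝ => (ε ^ N)⁻¹ *
      ∫ y in Metric.ball x ε ∩ {y | inner ℝ (y - x) ν < 0}, ‖u y - b‖) (𝓝[>] 0) (𝓝 0)

/-- The jump set `S_u ⊆ Ω`. -/
def jumpSet (Ω : Set (Sp N)) (u : Sp N → Sp d) : Set (Sp N) :=
  {x | x ∈ Ω ∧ ∃ a b ν, IsJumpTriple u x a b ν}

open Classical in
/-- The matrix `[u](x) ⊗ ν_u(x) = (u⁺(x) - u⁻(x)) ⊗ ν_u(x)` at a jump point `x`; it does not depend
on the choice of the triple, which is unique up to exchanging `a` and `b` and changing the sign of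
`ν`. -/
def jumpTensor (u : Sp N → Sp d) (x : Sp N) : Matrix (Fin d) (Fin N) ℝ :=
  if h : ∃ t : Sp d × Sp d × Sp N, IsJumpTriple u x t.1 t.2.1 t.2.2 then
    Matrix.of fun i j => (h.choose.1 i - h.choose.2.1 i) * h.choose.2.2 j
  else 0

/-- `D^j u = [u] ⊗ ν_u ℋ^{N-1} ⌊ S_u`. The measure `μHE[N - 1]` is the Hausdorff measure `ℋ^{N-1}`,
normalized so that it agrees with Lebesgue measure on `ℝ^{N-1}`. -/
def jumpDeriv (Ω : Set (Sp N)) (u : Sp N → Sp d) : MatMeasure d N :=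
  Matrix.of fun i j =>
    ((μHE[N - 1] : Measure (Sp N)).restrict (jumpSet Ω u)).withDensityᵥ
      (fun x => jumpTensor u x i j)

/-- `D^c u`, the rest of the singular part. -/
def cantorDeriv (Ω : Set (Sp N)) (u : Sp N → Sp d) : MatMeasure d N :=
  singDeriv Ω u - jumpDeriv Ω u

/-- `u ∈ SBV(Ω; ℝ^d)`: `u` is of bounded variation and `D^c u = 0`. The integrability, which says
that `[u] ⊗ ν_u ℋ^{N-1} ⌊ S_u` is a finite measure, holds for every function of bounded variation;
it only makes sure that `jumpDeriv` has no default value. -/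
def IsSBV (Ω : Set (Sp N)) (u : Sp N → Sp d) : Prop :=
  IsBV Ω u ∧
  (∀ i j, IntegrableOn (fun x => jumpTensor u x i j) (jumpSet Ω u) μHE[N - 1]) ∧
  cantorDeriv Ω u = 0

/-- `(g, G) ∈ SD(Ω) = SBV(Ω; ℝ^d) × L¹(Ω; ℝ^{d × N})`. -/
def IsStructuredDeformation (Ω : Set (Sp N)) (g : Sp N → Sp d)
    (G : Sp N → Matrix (Fin d) (Fin N) ℝ) : Prop :=
  IsSBV Ω g ∧ ∀ i j, IntegrableOn (fun x => G x i j) Ω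

/-- The matrix-valued measure `F ℒ^N` on `Ω`. -/
def densityMeasure (Ω : Set (Sp N)) (F : Sp N → Matrix (Fin d) (Fin N) ℝ) : MatMeasure d N :=
  Matrix.of fun i j => (volume.restrict Ω).withDensityᵥ (fun x => F x i j)

/-- Weak-* convergence in `ℳ(Ω; ℝ^{d × N})`. The test functions are those in `C_0(Ω)`, extended
by zero to `ℝ^N`. -/
def WeakStarTendsto (Ω : Set (Sp N)) (μ : ℕ → MatMeasure d N) (ν : MatMeasure d N) : Prop :=
  ∀ φ : C₀(Sp N, ℝ), (∀ x ∉ Ω, φ x = 0) → ∀ i j,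
    Tendsto (fun n => ∫ᵛ x, φ x ∂•(μ n i j)) atTop (𝓝 (∫ᵛ x, φ x ∂•(ν i j)))

/-- The sequence `u` belongs to `Ad(g, G)`. -/
structure IsAdmissible (Ω : Set (Sp N)) (g : Sp N → Sp d) (G : Sp N → Matrix (Fin d) (Fin N) ℝ)
    (u : ℕ → Sp N → Sp d) : Prop where
  sbv : ∀ n, IsSBV Ω (u n)
  tendsto_L1 : Tendsto (fun n => eLpNorm (u n - g) 1 (volume.restrict Ω)) atTop (𝓝 0)
  tendsto_grad : WeakStarTendsto Ω (fun n => densityMeasure Ω (grad Ω (u n))) (densityMeasure Ω G)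
  tendsto_sing : WeakStarTendsto Ω (fun n => singDeriv Ω (u n))
    (densityMeasure Ω (fun x => grad Ω g x - G x) + singDeriv Ω g)

/-- `α ∈ C_c^∞(ℝ^N)` has its support in the open unit ball, and integral one. -/
structure IsKernel (α : Sp N → ℝ) : Prop where
  smooth : ContDiff ℝ ∞ α
  support : tsupport α ⊆ Metric.ball 0 1
  integral : ∫ x in Metric.ball (0 : Sp N) 1, α x = 1

/-- `α_r(x) = r^{-N} α(x / r)`. -/
def rescale (α : Sp N → ℝ) (r : ℝ) (x : Sp N) : ℝ := (r ^ N)⁻¹ * α (r⁻¹ • x)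

/-- `Ω_r`, the points of `Ω` at distance more than `r` from the boundary. -/
def innerSet (Ω : Set (Sp N)) (r : ℝ) : Set (Sp N) :=
  {x | x ∈ Ω ∧ r < Metric.infDist x (frontier Ω)}

/-- The convolution `(μ * f)(x) = ∫ f(x - y) dμ(y)`. -/
def conv (μ : MatMeasure d N) (f : Sp N → ℝ) (x : Sp N) : Matrix (Fin d) (Fin N) ℝ :=
  Matrix.of fun i j => ∫ᵛ y, f (x - y) ∂•(μ i j)

/-- `∫_{B_r(x) ∩ S_u} α_r(x - y) [u](y) ⊗ ν_u(y) dℋ^{N-1}(y)`. -/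
def jumpAverage (Ω : Set (Sp N)) (α : Sp N → ℝ) (r : ℝ) (u : Sp N → Sp d) (x : Sp N) :
    Matrix (Fin d) (Fin N) ℝ :=
  Matrix.of fun i j =>
    ∫ y in Metric.ball x r ∩ jumpSet Ω u, rescale α r (x - y) * jumpTensor u y i j ∂μHE[N - 1]

/-- `∫_{B_r(x)} α_r(x - y) F(y) dy`. -/
def bulkAverage (α : Sp N → ℝ) (r : ℝ) (F : Sp N → Matrix (Fin d) (Fin N) ℝ) (x : Sp N) :
    Matrix (Fin d) (Fin N) ℝ :=
  Matrix.of fun i j => ∫ y in Metric.ball x r, rescale α r (x - y) * F y i j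

/-- The averaged interfacial energy `E^{α_r}(u)`. -/
def energy (Ω : Set (Sp N)) (Ψ : Sp N → Matrix (Fin d) (Fin N) ℝ → ℝ) (α : Sp N → ℝ) (r : ℝ)
    (u : Sp N → Sp d) : ℝ :=
  ∫ x in innerSet Ω r, Ψ x (conv (singDeriv Ω u) (rescale α r) x)

/-- The upscaled energy `I^{α_r}(g, G; Ω_r)`. -/
def upscaledEnergy (Ω : Set (Sp N)) (Ψ : Sp N → Matrix (Fin d) (Fin N) ℝ → ℝ) (α : Sp N → ℝ)
    (r : ℝ) (g : Sp N → Sp d) (G : Sp N → Matrix (Fin d) (Fin N) ℝ) : ℝ :=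
  ∫ x in innerSet Ω r, Ψ x
    (bulkAverage α r (fun y => grad Ω g y - G y) x + jumpAverage Ω α r g x)

end SD

end

/-!
For `x ∈ Ω_r` the ball `B_r(x)` lies in `Ω`, so `y ↦ α_r(x - y)` is an admissible test function in
`C_0(Ω)`. Weak-* convergence of `D^s u_n` therefore yields pointwise convergence of the averages
`D^s u_n * α_r` on `Ω_r`. The Banach–Steinhaus theorem on the Banach space `C_0(Ω)`
(`exists_forall_abs_integral_le_mul_norm`) bounds these averages uniformly in `n` and `x`, so on
`Ω_r` the pairs `(x, (D^s u_n * α_r)(x))` stay in a compact subset of `Ω × ℝ^{d × N}`, where `Ψ` is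
bounded. As `Ω_r` has finite measure, dominated convergence passes to the limit in the energies
(`tendsto_setIntegral_comp_of_bounded`).

The formulas in terms of jumps come from `D^s u = [u] ⊗ ν_u ℋ^{N-1} ⌊ S_u` for `u ∈ SBV`, and from
the fact that integrating against a vector measure with a density is integrating against the product
with the density (`integral_withDensityᵥ`). The limit measure `(∇g - G) ℒ^N + D^s g` is treated in
the same way.
-/

namespace SD

variable {d N : ℕ}

/-! ### Integration against signed measures -/

section SignedMeasure

variable {X : Type*} [MeasurableSpace X]

instance isFiniteMeasure_variation (μ : SignedMeasure X) : IsFiniteMeasure μ.variation := by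
  rw [← SignedMeasure.totalVariation_eq_variation]
  infer_instance

theorem integrable_of_abs_le (μ : SignedMeasure X) {f : X → ℝ} (hf : StronglyMeasurable f) {C : ℝ}
    (hC : ∀ x, |f x| ≤ C) : μ.Integrable f :=
  Integrable.of_bound hf.aestronglyMeasurable C (Eventually.of_forall hC)

/-- For scalar functions, the two orders of the scalar multiplication give the same integral, so
that `integral_toSignedMeasure` also covers the notation `∂•`. -/
theorem integral_smul_toSignedMeasure (μ : Measure X) [IsFiniteMeasure μ] (f : X → ℝ) :
    ∫ᵛ x, f x ∂•μ.toSignedMeasure = ∫ x, f x ∂μ := by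
  have h : (ContinuousLinearMap.lsmul ℝ ℝ : ℝ →L[ℝ] ℝ →L[ℝ] ℝ)
      = (ContinuousLinearMap.lsmul ℝ ℝ).flip := by
    ext
    simp
  rw [h]
  exact VectorMeasure.integral_toSignedMeasure

theorem integral_withDensityᵥ {μ : Measure X} {h : X → ℝ} (hh : Integrable h μ) {f : X → ℝ}
    (hf : StronglyMeasurable f) {C : ℝ} (hC : ∀ x, |f x| ≤ C) :
    ∫ᵛ x, f x ∂•(μ.withDensityᵥ h) = ∫ x, f x * h x ∂μ := by
  have hfin := isFiniteMeasure_withDensity_ofReal hh.2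
  have hfin' : IsFiniteMeasure (μ.withDensity fun x => ENNReal.ofReal (-h x)) :=
    isFiniteMeasure_withDensity_ofReal hh.neg.2
  have hpos : Integrable (fun x => max (h x) 0 * f x) μ :=
    hh.pos_part.mul_bdd hf.aestronglyMeasurable (Eventually.of_forall hC)
  have hneg : Integrable (fun x => max (-h x) 0 * f x) μ :=
    hh.neg_part.mul_bdd hf.aestronglyMeasurable (Eventually.of_forall hC)
  rw [withDensityᵥ_eq_withDensity_pos_part_sub_withDensity_neg_part hh,
    VectorMeasure.integral_sub_vectorMeasure (integrable_of_abs_le _ hf hC)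
      (integrable_of_abs_le _ hf hC),
    integral_smul_toSignedMeasure, integral_smul_toSignedMeasure,
    integral_withDensity_eq_integral_toReal_smul₀ hh.aemeasurable.ennreal_ofReal (by simp),
    integral_withDensity_eq_integral_toReal_smul₀
      (f := fun x => ENNReal.ofReal (-h x)) hh.neg.aemeasurable.ennreal_ofReal (by simp)]
  simp only [ENNReal.toReal_ofReal', smul_eq_mul]
  rw [← integral_sub hpos hneg]
  congr 1 with x
  rw [← sub_mul, max_zero_sub_max_neg_zero_eq_self, mul_comm]

end SignedMeasure

/-! ### Uniform bounds from weak-* convergence -/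

/-- The Banach–Steinhaus theorem for functionals that are pointwise bounded only on a closed
subspace. -/
theorem banach_steinhaus_of_isClosed {E ι : Type*} [NormedAddCommGroup E] [NormedSpace ℝ E]
    [CompleteSpace E] {S : Submodule ℝ E} (hS : IsClosed (S : Set E)) (L : ι → E →L[ℝ] ℝ)
    (h : ∀ x ∈ S, ∃ C, ∀ i, ‖L i x‖ ≤ C) : ∃ C, ∀ i, ∀ x ∈ S, ‖L i x‖ ≤ C * ‖x‖ := by
  have : CompleteSpace S := hS.completeSpace_coe
  obtain ⟨C, hC⟩ := banach_steinhaus (g := fun i => (L i).comp S.subtypeL) fun x => h x x.2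
  exact ⟨C, fun i x hx => ((L i).comp S.subtypeL).le_of_opNorm_le (hC i) ⟨x, hx⟩⟩

section UniformBound

variable {X : Type*} [TopologicalSpace X]

/-- `C_0(Ω)`, as the subspace of those functions in `C₀(X, ℝ)` that vanish outside `Ω`. -/
def vanishingOutside (Ω : Set X) : Submodule ℝ C₀(X, ℝ) where
  carrier := {φ | ∀ x ∉ Ω, φ x = 0}
  add_mem' hφ hψ x hx := by simp [hφ x hx, hψ x hx]
  zero_mem' := by simp
  smul_mem' c φ hφ x hx := by simp [hφ x hx]

theorem abs_apply_le_norm (φ : C₀(X, ℝ)) (x : X) : |φ x| ≤ ‖φ‖ :=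
  φ.toBCF.norm_coe_le_norm x

theorem isClosed_vanishingOutside (Ω : Set X) :
    IsClosed (vanishingOutside Ω : Set C₀(X, ℝ)) := by
  have h : (vanishingOutside Ω : Set C₀(X, ℝ)) = ⋂ x ∈ Ωᶜ, {φ | φ x = 0} := by
    ext φ
    simp only [mem_iInter]
    rfl
  rw [h]
  refine isClosed_biInter fun x _ => isClosed_eq ?_ continuous_const
  have hl : LipschitzWith 1 (fun φ : C₀(X, ℝ) => φ x) := by
    refine LipschitzWith.of_dist_le_mul fun φ ψ => ?_
    rw [NNReal.coe_one, one_mul, dist_eq_norm φ ψ]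
    exact abs_apply_le_norm (φ - ψ) x
  exact hl.continuous

variable [MeasurableSpace X] [OpensMeasurableSpace X]

theorem integrable_zeroAtInfty (μ : SignedMeasure X) (φ : C₀(X, ℝ)) :
    μ.Integrable φ :=
  integrable_of_abs_le μ φ.continuous.measurable.stronglyMeasurable (abs_apply_le_norm φ)

/-- Integration against a signed measure, as a continuous functional on `C₀(X, ℝ)`. -/
noncomputable def integralCLM (μ : SignedMeasure X) : C₀(X, ℝ) →L[ℝ] ℝ :=
  LinearMap.mkContinuous
    { toFun := fun φ => ∫ᵛ x, φ x ∂•μ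
      map_add' := fun φ ψ =>
        VectorMeasure.integral_add (integrable_zeroAtInfty μ φ) (integrable_zeroAtInfty μ ψ)
      map_smul' := fun c φ => VectorMeasure.integral_smul φ μ _ c }
    (μ.variation.real univ) fun φ => by
      refine (VectorMeasure.norm_integral_le_of_norm_le_const
        (Eventually.of_forall (abs_apply_le_norm φ))).trans_eq ?_
      rw [ContinuousLinearMap.opNorm_lsmul]
      ring

/-- A sequence of signed measures converging weakly-* on `Ω` is bounded in the dual of `C_0(Ω)`. -/
theorem exists_forall_abs_integral_le_mul_norm (Ω : Set X) (μ : ℕ → SignedMeasure X)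
    (ν : SignedMeasure X)
    (h : ∀ φ : C₀(X, ℝ), (∀ x ∉ Ω, φ x = 0) →
      Tendsto (fun n => ∫ᵛ x, φ x ∂•(μ n)) atTop (𝓝 (∫ᵛ x, φ x ∂•ν))) :
    ∃ C, ∀ n, ∀ φ : C₀(X, ℝ), (∀ x ∉ Ω, φ x = 0) → |∫ᵛ x, φ x ∂•(μ n)| ≤ C * ‖φ‖ := by
  have hbdd : ∀ φ ∈ vanishingOutside Ω, ∃ C, ∀ n, ‖integralCLM (μ n) φ‖ ≤ C := fun φ hφ => by
    obtain ⟨C, hC⟩ := (h φ hφ).norm.bddAbove_range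
    exact ⟨C, fun n => hC ⟨n, rfl⟩⟩
  exact banach_steinhaus_of_isClosed (isClosed_vanishingOutside Ω) (fun n => integralCLM (μ n)) hbdd

end UniformBound

/-! ### The rescaled kernel -/

theorem IsKernel.continuous_rescale {α : Sp N → ℝ} (hα : IsKernel α) (r : ℝ) :
    Continuous (rescale α r) := by
  have := hα.smooth.continuous
  unfold rescale
  fun_prop

theorem IsKernel.norm_lt_of_rescale_ne_zero {α : Sp N → ℝ} (hα : IsKernel α) {r : ℝ} (hr : 0 < r)
    {x : Sp N} (hx : rescale α r x ≠ 0) : ‖x‖ < r := by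
  have h : r⁻¹ • x ∈ Metric.ball (0 : Sp N) 1 :=
    hα.support (subset_tsupport _ (right_ne_zero_of_mul hx))
  rw [mem_ball_zero_iff, norm_smul, norm_inv, Real.norm_of_nonneg hr.le,
    inv_mul_lt_iff₀ hr, mul_one] at h
  exact h

theorem IsKernel.rescale_sub_eq_zero {α : Sp N → ℝ} (hα : IsKernel α) {r : ℝ} (hr : 0 < r)
    {x y : Sp N} (hy : y ∉ Metric.ball x r) : rescale α r (x - y) = 0 := by
  by_contra h
  exact hy (by simpa [dist_eq_norm, norm_sub_rev] using hα.norm_lt_of_rescale_ne_zero hr h)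

theorem IsKernel.hasCompactSupport_rescale {α : Sp N → ℝ} (hα : IsKernel α) {r : ℝ}
    (hr : 0 < r) : HasCompactSupport (rescale α r) :=
  HasCompactSupport.intro (isCompact_closedBall (0 : Sp N) r) fun x hx => by
    by_contra h
    exact hx (by simpa using (hα.norm_lt_of_rescale_ne_zero hr h).le)

theorem IsKernel.exists_abs_rescale_le {α : Sp N → ℝ} (hα : IsKernel α) {r : ℝ} (hr : 0 < r) :
    ∃ C, ∀ x, |rescale α r x| ≤ C :=
  (hα.continuous_rescale r).bounded_above_of_compact_support (hα.hasCompactSupport_rescale hr)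

/-- The test function `y ↦ α_r(x - y)`. -/
noncomputable def kernelTest {α : Sp N → ℝ} (hα : IsKernel α) {r : ℝ} (hr : 0 < r) (x : Sp N) :
    C₀(Sp N, ℝ) where
  toFun y := rescale α r (x - y)
  continuous_toFun := (hα.continuous_rescale r).comp (continuous_const.sub continuous_id)
  zero_at_infty' := by
    refine HasCompactSupport.is_zero_at_infty ?_
    exact (hα.hasCompactSupport_rescale hr).comp_homeomorph (Homeomorph.subLeft x)

theorem continuous_conv (μ : MatMeasure d N) {f : Sp N → ℝ} (hf : Continuous f) {C : ℝ}
    (hC : ∀ x, |f x| ≤ C) : Continuous (conv μ f) := by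
  refine continuous_matrix fun i j => ?_
  refine VectorMeasure.continuous_of_dominated (bound := fun _ => C) (fun x => ?_)
    (fun x => Eventually.of_forall fun y => hC _) (integrable_const C)
    (Eventually.of_forall fun y => hf.comp (continuous_id.sub continuous_const))
  exact (hf.comp (continuous_const.sub continuous_id)).measurable.aestronglyMeasurable

/-! ### The inner set -/

theorem isOpen_innerSet {Ω : Set (Sp N)} (hΩ : IsOpen Ω) (r : ℝ) : IsOpen (innerSet Ω r) :=
  hΩ.inter (isOpen_lt continuous_const (Metric.continuous_infDist_pt _))

/-- `Ω_r` is relatively compact in `Ω`. -/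
theorem exists_isCompact_innerSet_subset {Ω : Set (Sp N)} (hΩb : Bornology.IsBounded Ω) {r : ℝ}
    (hr : 0 < r) : ∃ K, IsCompact K ∧ innerSet Ω r ⊆ K ∧ K ⊆ Ω := by
  refine ⟨closure Ω ∩ {x | r ≤ Metric.infDist x (frontier Ω)},
    hΩb.isCompact_closure.inter_right
      (isClosed_le continuous_const (Metric.continuous_infDist_pt _)),
    fun x hx => ⟨subset_closure hx.1, hx.2.le⟩, fun x hx => ?_⟩
  by_contra hxΩ
  have hfr : x ∈ frontier Ω := ⟨hx.1, fun h => hxΩ (interior_subset h)⟩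
  have hx2 : r ≤ Metric.infDist x (frontier Ω) := hx.2
  rw [Metric.infDist_zero_of_mem hfr] at hx2
  exact hr.not_ge hx2

theorem ball_subset_of_mem_innerSet {Ω : Set (Sp N)} (hΩ : IsOpen Ω) {r : ℝ} (hr : 0 < r) {x : Sp N}
    (hx : x ∈ innerSet Ω r) : Metric.ball x r ⊆ Ω := by
  -- The ball is connected, meets `Ω` at `x`, and does not meet the boundary.
  refine (convex_ball x r).isPreconnected.subset_left_of_subset_union hΩ
    isClosed_closure.isOpen_compl
    (disjoint_compl_right_iff_subset.2 subset_closure) (fun z hz => ?_)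
    ⟨x, Metric.mem_ball_self hr, hx.1⟩
  by_contra hz'
  rw [mem_union, not_or, notMem_compl_iff] at hz'
  have hfr : z ∈ frontier Ω := ⟨hz'.2, fun h => hz'.1 (interior_subset h)⟩
  have h := (Metric.infDist_le_dist_of_mem hfr).trans_lt (Metric.mem_ball'.1 hz)
  exact lt_asymm h hx.2

theorem kernelTest_eq_zero {Ω : Set (Sp N)} (hΩ : IsOpen Ω) {α : Sp N → ℝ}
    (hα : IsKernel α) {r : ℝ} (hr : 0 < r) {x : Sp N} (hx : x ∈ innerSet Ω r) :
    ∀ y ∉ Ω, kernelTest hα hr x y = 0 := fun _ hy =>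
  hα.rescale_sub_eq_zero hr fun h => hy (ball_subset_of_mem_innerSet hΩ hr hx h)

/-! ### Averages in terms of densities and jumps -/

theorem setIntegral_ball_inter {α : Sp N → ℝ} (hα : IsKernel α) {r : ℝ} (hr : 0 < r)
    (μ : Measure (Sp N)) (S : Set (Sp N)) (h : Sp N → ℝ) (x : Sp N) :
    ∫ y in Metric.ball x r ∩ S, rescale α r (x - y) * h y ∂μ =
      ∫ y in S, rescale α r (x - y) * h y ∂μ := by
  rw [← Measure.restrict_restrict Metric.isOpen_ball.measurableSet]
  refine setIntegral_eq_integral_of_forall_compl_eq_zero fun y hy => ?_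
  rw [hα.rescale_sub_eq_zero hr hy, zero_mul]

theorem integral_rescale_withDensityᵥ {α : Sp N → ℝ} (hα : IsKernel α) {r : ℝ} (hr : 0 < r)
    {μ : Measure (Sp N)} {S : Set (Sp N)} {h : Sp N → ℝ} (hh : IntegrableOn h S μ) (x : Sp N) :
    ∫ᵛ y, rescale α r (x - y) ∂•((μ.restrict S).withDensityᵥ h) =
      ∫ y in Metric.ball x r ∩ S, rescale α r (x - y) * h y ∂μ := by
  obtain ⟨C, hC⟩ := hα.exists_abs_rescale_le hr
  rw [setIntegral_ball_inter hα hr, integral_withDensityᵥ hh _ (fun y => hC (x - y))]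
  exact (kernelTest hα hr x).continuous.measurable.stronglyMeasurable

theorem IsSBV.singDeriv_eq {Ω : Set (Sp N)} {u : Sp N → Sp d} (hu : IsSBV Ω u) :
    singDeriv Ω u = jumpDeriv Ω u :=
  sub_eq_zero.1 hu.2.2

theorem IsSBV.conv_singDeriv {Ω : Set (Sp N)} {u : Sp N → Sp d} (hu : IsSBV Ω u)
    {α : Sp N → ℝ} (hα : IsKernel α) {r : ℝ} (hr : 0 < r) (x : Sp N) :
    conv (singDeriv Ω u) (rescale α r) x = jumpAverage Ω α r u x := by
  ext i j
  rw [hu.singDeriv_eq]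
  exact integral_rescale_withDensityᵥ hα hr (hu.2.1 i j) x

theorem conv_densityMeasure {Ω : Set (Sp N)} (hΩ : IsOpen Ω) {α : Sp N → ℝ} (hα : IsKernel α)
    {r : ℝ} (hr : 0 < r) {F : Sp N → Matrix (Fin d) (Fin N) ℝ}
    (hF : ∀ i j, IntegrableOn (fun x => F x i j) Ω) {x : Sp N} (hx : x ∈ innerSet Ω r) :
    conv (densityMeasure Ω F) (rescale α r) x = bulkAverage α r F x := by
  ext i j
  refine (integral_rescale_withDensityᵥ hα hr (hF i j) x).trans ?_
  rw [inter_eq_left.2 (ball_subset_of_mem_innerSet hΩ hr hx)]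
  rfl

theorem conv_add {α : Sp N → ℝ} (hα : IsKernel α) {r : ℝ} (hr : 0 < r) (μ ν : MatMeasure d N)
    (x : Sp N) : conv (μ + ν) (rescale α r) x =
      conv μ (rescale α r) x + conv ν (rescale α r) x := by
  ext i j
  exact VectorMeasure.integral_add_vectorMeasure (integrable_zeroAtInfty _ (kernelTest hα hr x))
    (integrable_zeroAtInfty _ (kernelTest hα hr x))

theorem integrableOn_grad (Ω : Set (Sp N)) (u : Sp N → Sp d) (i : Fin d) (j : Fin N) :
    IntegrableOn (fun x => grad Ω u x i j) Ω :=
  (SignedMeasure.integrable_rnDeriv _ volume).integrableOn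

theorem conv_limit {Ω : Set (Sp N)} (hΩ : IsOpen Ω) {g : Sp N → Sp d}
    {G : Sp N → Matrix (Fin d) (Fin N) ℝ}
    (hgG : IsStructuredDeformation Ω g G) {α : Sp N → ℝ} (hα : IsKernel α) {r : ℝ} (hr : 0 < r)
    {x : Sp N} (hx : x ∈ innerSet Ω r) :
    conv (densityMeasure Ω (fun x => grad Ω g x - G x) + singDeriv Ω g) (rescale α r) x =
      bulkAverage α r (fun y => grad Ω g y - G y) x + jumpAverage Ω α r g x := by
  rw [conv_add hα hr, hgG.1.conv_singDeriv hα hr,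
    conv_densityMeasure hΩ hα hr (F := fun x => grad Ω g x - G x)
      (fun i j => (integrableOn_grad Ω g i j).sub (hgG.2 i j)) hx]

/-! ### Convergence of the averages and of the energies -/

theorem WeakStarTendsto.tendsto_conv {Ω : Set (Sp N)} {μ : ℕ → MatMeasure d N} {ν : MatMeasure d N}
    (h : WeakStarTendsto Ω μ ν) (hΩ : IsOpen Ω) {α : Sp N → ℝ} (hα : IsKernel α) {r : ℝ}
    (hr : 0 < r) {x : Sp N} (hx : x ∈ innerSet Ω r) :
    Tendsto (fun n => conv (μ n) (rescale α r) x) atTop (𝓝 (conv ν (rescale α r) x)) := by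
  refine tendsto_pi_nhds.2 fun i => tendsto_pi_nhds.2 fun j => ?_
  exact h (kernelTest hα hr x) (kernelTest_eq_zero hΩ hα hr hx) i j

theorem WeakStarTendsto.exists_abs_conv_le {Ω : Set (Sp N)} {μ : ℕ → MatMeasure d N}
    {ν : MatMeasure d N} (h : WeakStarTendsto Ω μ ν) (hΩ : IsOpen Ω) {α : Sp N → ℝ}
    (hα : IsKernel α) {r : ℝ} (hr : 0 < r) :
    ∃ C, ∀ n, ∀ x ∈ innerSet Ω r, ∀ i j, |conv (μ n) (rescale α r) x i j| ≤ C := by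
  choose C hC using fun i j => exists_forall_abs_integral_le_mul_norm Ω (fun n => μ n i j) (ν i j)
    fun φ hφ => h φ hφ i j
  obtain ⟨M, hM⟩ := hα.exists_abs_rescale_le hr
  have hM0 : 0 ≤ M := (abs_nonneg _).trans (hM 0)
  refine ⟨(∑ i, ∑ j, |C i j|) * M, fun n x hx i j => ?_⟩
  have hnorm : ‖kernelTest hα hr x‖ ≤ M :=
    (BoundedContinuousFunction.norm_le hM0).2 fun y => hM (x - y)
  have hCij : |C i j| ≤ ∑ i, ∑ j, |C i j| :=
    (Finset.single_le_sum (f := fun j => |C i j|) (fun _ _ => abs_nonneg _)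
      (Finset.mem_univ j)).trans
      (Finset.single_le_sum (f := fun i => ∑ j, |C i j|)
        (fun _ _ => Finset.sum_nonneg fun _ _ => abs_nonneg _) (Finset.mem_univ i))
  calc |conv (μ n) (rescale α r) x i j|
      ≤ C i j * ‖kernelTest hα hr x‖ :=
        hC i j n (kernelTest hα hr x) (kernelTest_eq_zero hΩ hα hr hx)
    _ ≤ |C i j| * ‖kernelTest hα hr x‖ := by gcongr; exact le_abs_self _
    _ ≤ (∑ i, ∑ j, |C i j|) * M := by gcongr

/-- Dominated convergence for `∫ Ψ(x, A_n(x)) dx` on a set `U` that is relatively compact in `Ω`,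
when the `A_n` are continuous, uniformly bounded, and converge pointwise. -/
theorem tendsto_setIntegral_comp_of_bounded {Ω U K : Set (Sp N)} (hU : IsOpen U)
    (hK : IsCompact K) (hUK : U ⊆ K) (hKΩ : K ⊆ Ω)
    {Ψ : Sp N → Matrix (Fin d) (Fin N) ℝ → ℝ}
    (hΨ : ContinuousOn (Function.uncurry Ψ) (Ω ×ˢ univ))
    {A : ℕ → Sp N → Matrix (Fin d) (Fin N) ℝ} {B : Sp N → Matrix (Fin d) (Fin N) ℝ}
    (hA : ∀ n, Continuous (A n)) (hB : Continuous B) {C : ℝ}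
    (hC : ∀ n, ∀ x ∈ U, ∀ i j, |A n x i j| ≤ C)
    (hlim : ∀ x ∈ U, Tendsto (fun n => A n x) atTop (𝓝 (B x))) :
    (∀ n, IntegrableOn (fun x => Ψ x (A n x)) U) ∧ IntegrableOn (fun x => Ψ x (B x)) U ∧
      Tendsto (fun n => ∫ x in U, Ψ x (A n x)) atTop (𝓝 (∫ x in U, Ψ x (B x))) := by
  let Q : Set (Matrix (Fin d) (Fin N) ℝ) := univ.pi fun _ => univ.pi fun _ => Icc (-C) C
  have hQ : IsCompact Q := isCompact_univ_pi fun _ => isCompact_univ_pi fun _ => isCompact_Icc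
  have hAQ : ∀ n, ∀ x ∈ U, A n x ∈ Q := fun n x hx i _ j _ => abs_le.1 (hC n x hx i j)
  have hBQ : ∀ x ∈ U, B x ∈ Q := fun x hx =>
    hQ.isClosed.mem_of_tendsto (hlim x hx) (Eventually.of_forall fun n => hAQ n x hx)
  obtain ⟨M, hM⟩ := (hK.prod hQ).exists_bound_of_continuousOn
    (hΨ.mono (prod_mono hKΩ (subset_univ _)))
  have hUfin : volume U ≠ ⊤ := ((measure_mono hUK).trans_lt hK.measure_lt_top).ne
  have hcont : ∀ A : Sp N → Matrix (Fin d) (Fin N) ℝ, Continuous A →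
      ContinuousOn (fun x => Ψ x (A x)) U := fun A hA =>
    hΨ.comp (continuous_id.prodMk hA).continuousOn fun x hx => ⟨hKΩ (hUK hx), mem_univ _⟩
  have hmeas : ∀ A : Sp N → Matrix (Fin d) (Fin N) ℝ, Continuous A →
      AEStronglyMeasurable (fun x => Ψ x (A x)) (volume.restrict U) := fun A hA =>
    (hcont A hA).aestronglyMeasurable hU.measurableSet
  have hint : ∀ A : Sp N → Matrix (Fin d) (Fin N) ℝ, Continuous A → (∀ x ∈ U, A x ∈ Q) →
      IntegrableOn (fun x => Ψ x (A x)) U := fun A hA hAQ =>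
    IntegrableOn.of_bound hUfin.lt_top (hmeas A hA) M
      ((ae_restrict_mem hU.measurableSet).mono fun x hx => hM (x, A x) ⟨hUK hx, hAQ x hx⟩)
  refine ⟨fun n => hint _ (hA n) (hAQ n), hint _ hB hBQ, ?_⟩
  refine tendsto_integral_of_dominated_convergence (fun _ => M) (fun n => hmeas _ (hA n))
    (integrableOn_const hUfin) (fun n => ?_) ?_
  · exact (ae_restrict_mem hU.measurableSet).mono fun x hx =>
      hM (x, A n x) ⟨hUK hx, hAQ n x hx⟩
  · refine (ae_restrict_mem hU.measurableSet).mono fun x hx => ?_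
    have hnhds : Ω ×ˢ univ ∈ 𝓝 (x, B x) :=
      prod_mem_nhds (mem_of_superset (hU.mem_nhds hx) (hUK.trans hKΩ)) univ_mem
    exact (hΨ.continuousAt hnhds).tendsto.comp (tendsto_const_nhds.prodMk_nhds (hlim x hx))

end SD

theorem theorem3p1 {d N : ℕ} (hN : 1 ≤ N)
    (Ω : Set (SD.Sp N)) (hΩo : IsOpen Ω) (hΩb : Bornology.IsBounded Ω)
    (Ψ : SD.Sp N → Matrix (Fin d) (Fin N) ℝ → ℝ)
    (hΨc : ContinuousOn (Function.uncurry Ψ) (Ω ×ˢ univ))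
    (hΨ0 : ∀ x ∈ Ω, ∀ A, 0 ≤ Ψ x A)
    (α : SD.Sp N → ℝ) (hα : SD.IsKernel α) (r : ℝ) (hr : 0 < r)
    (g : SD.Sp N → SD.Sp d) (G : SD.Sp N → Matrix (Fin d) (Fin N) ℝ)
    (hgG : SD.IsStructuredDeformation Ω g G)
    (u : ℕ → SD.Sp N → SD.Sp d) (hu : SD.IsAdmissible Ω g G u) :
    -- all the energies are finite (the integrands are integrable)
    (∀ n, IntegrableOn (fun x => Ψ x (SD.conv (SD.singDeriv Ω (u n)) (SD.rescale α r) x))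
      (SD.innerSet Ω r)) ∧
    IntegrableOn (fun x => Ψ x
      (SD.bulkAverage α r (fun y => SD.grad Ω g y - G y) x + SD.jumpAverage Ω α r g x))
      (SD.innerSet Ω r) ∧
    -- the averaged interfacial energy in terms of the jumps
    (∀ n, SD.energy Ω Ψ α r (u n) = ∫ x in SD.innerSet Ω r, Ψ x (SD.jumpAverage Ω α r (u n) x)) ∧
    -- the energies converge to the upscaled energy
    Tendsto (fun n => SD.energy Ω Ψ α r (u n)) atTop (𝓝 (SD.upscaledEnergy Ω Ψ α r g G)) := by
  obtain ⟨C, hC⟩ := hα.exists_abs_rescale_le hr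
  obtain ⟨K, hK, hUK, hKΩ⟩ := SD.exists_isCompact_innerSet_subset hΩb hr
  have hU := SD.isOpen_innerSet hΩo r
  obtain ⟨M, hM⟩ := hu.tendsto_sing.exists_abs_conv_le hΩo hα hr
  have hcont := fun μ : SD.MatMeasure d N => SD.continuous_conv μ (hα.continuous_rescale r) hC
  obtain ⟨hint, hint_lim, hlim⟩ := SD.tendsto_setIntegral_comp_of_bounded hU hK hUK hKΩ hΨc
    (fun n => hcont _) (hcont _) hM fun x hx => hu.tendsto_sing.tendsto_conv hΩo hα hr hx
  have heq : EqOn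
      (fun x => Ψ x (SD.conv (SD.densityMeasure Ω (fun x => SD.grad Ω g x - G x)
        + SD.singDeriv Ω g) (SD.rescale α r) x))
      (fun x => Ψ x (SD.bulkAverage α r (fun y => SD.grad Ω g y - G y) x
        + SD.jumpAverage Ω α r g x)) (SD.innerSet Ω r) := fun x hx =>
    congrArg (Ψ x) (SD.conv_limit hΩo hgG hα hr hx)
  refine ⟨hint, hint_lim.congr_fun heq hU.measurableSet, fun n => ?_, ?_⟩
  · simp only [SD.energy, (hu.sbv n).conv_singDeriv hα hr]
  · rw [setIntegral_congr_fun hU.measurableSet heq] at hlim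
    exact hlim
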